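/- Let $V>0$, $\lambda>0$, $T>0$, let $\mathbb T=\mathbb R/\mathbb Z$, $\Omega_V=\mathbb T\times\{-V,V\}$ and $\iota(x,v)=(x,-v)$. Let $\mathcal P(\Omega_V)$ be the space of Borel probability measures on $\Omega_V$ with the narrow topology, $\mathcal M(\Omega_V;\mathbb R^2)$ the space of pairs $j=(j^1,j^2)$ of finite signed Borel measures on $\Omega_V$, and $C^{1,0}(\Omega_V)$ the space of continuous functions $\varphi:\Omega_V\to\mathbb R$ whose partial derivative $\partial_x\varphi$ exists everywhere and is continuous. Write $\langle(\varphi_1,\varphi_2),j\rangle=\int\varphi_1\,dj^1+\int\varphi_2\,dj^2$. Fix $\sigma_0\in\mathcal P(\Omega_V)$. A curve $\sigma\in C([0,T];\mathcal P(\Omega_V))$ is a *weak solution* of the Kac equation $\partial_t\sigma+v\,\partial_x\sigma=\lambda(\iota_\sharp\sigma-\sigma)$, $\sigma|_{t=0}=\sigma_0$, if $\sigma|_{t=0}=\sigma_0$ and, for all $\varphi\in C^{1,0}(\Omega_V)$ and $0\le s\le t\le T$, $$\int\varphi\,d\sigma_t-\int\varphi\,d\sigma_s=\int_s^t\int\bigl[v\,\partial_x\varphi+\lambda(\varphi\circ\iota-\varphi)\bigr]\,d\sigma_r\,dr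 .$$ For a curve $\sigma\in C([0,T];\mathcal P(\Omega_V))$ and a family $j=(j_t)_{t\in(0,T)}\subset\mathcal M(\Omega_V;\mathbb R^2)$, write $(\sigma,j)\in\mathrm{CE}(0,T;\Omega_V)$ if $t\mapsto j_t(B)$ is Borel measurable for every Borel set $B\subset\Omega_V$, $\int_0^T\|j_t\|_{TV}\,dt<\infty$, where $\|j\|_{TV}=\sup\{\langle\varphi,j\rangle:\varphi=(\varphi_1,\varphi_2)\in C(\Omega_V;\mathbb R^2),\ |\varphi_1|,|\varphi_2|\le1\}$, and, for all $\varphi\in C^{1,0}(\Omega_V)$ and $0\le s\le t\le T$, $$\int\varphi\,d\sigma_t-\int\varphi\,d\sigma_s=\int_s^t\bigl\langle(\partial_x\varphi,\ \varphi\circ\iota-\varphi),j_r\bigr\rangle\,dr .$$ Let $$\mathscr H(\sigma,\varphi)=\int\bigl[v\,\varphi_1+\lambda(e^{\varphi_2}-1)\bigr]d\sigma,\qquad \mathscr L(\sigma,j)=\sup_{\varphi\in C(\Omega_V;\mathbb R^2)}\bigl(\langle\varphi,j\rangle-\mathscr H(\sigma,\varphi)\bigr)\in[0,\infty],$$ let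 $\mathscr I(\sigma,j)=\int_0^T\mathscr L(\sigma_t,j_t)\,dt$ if $(\sigma,j)\in\mathrm{CE}(0,T;\Omega_V)$ and $\mathscr I(\sigma,j)=+\infty$ otherwise, and let $\mathrm{Ent}(\mu|\nu)=\int(f\log f-f+1)\,d\nu$ if $\mu\ll\nu$ with $f=d\mu/d\nu$, and $\mathrm{Ent}(\mu|\nu)=+\infty$ otherwise. The curve $\sigma$ is a *variational solution* if there is a family $j$ with $(\sigma,j)\in\mathrm{CE}(0,T;\Omega_V)$ and $\mathrm{Ent}(\sigma|_{t=0}\,|\,\sigma_0)+\mathscr I(\sigma,j)=0$. **Theorem.** There exists a unique weak solution $\sigma\in C([0,T];\mathcal P(\Omega_V))$ of the Kac equation with initial datum $\sigma_0$. Moreover, a curve $\sigma\in C([0,T];\mathcal P(\Omega_V))$ is a weak solution if and only if it is a variational solution. -/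

import Mathlib

open scoped ENNReal

namespace Kac

open MeasureTheory VectorMeasure

noncomputable section

/-- The state space `𝕋 × {-V, V}`, with `𝕋 = ℝ / ℤ`. -/
abbrev Omega (V : ℝ) : Type := UnitAddCircle × ({-V, V} : Set ℝ)

/-- The velocity reversal `(x, v) ↦ (x, -v)`. -/
def flip {V : ℝ} (p : Omega V) : Omega V :=
  (p.1, ⟨-(p.2 : ℝ), by
    rcases p.2.2 with h | h
    · right
      simp [h]
    · left
      simp [Set.mem_singleton_iff.mp h]⟩)

/-- The spatial derivative `∂ₓ φ`, at every point. -/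
def dx {V : ℝ} (φ : Omega V → ℝ) (p : Omega V) : ℝ :=
  deriv (fun h : ℝ => φ (p.1 + (h : UnitAddCircle), p.2)) 0

/-- The discrete velocity derivative `φ ∘ ι - φ`, where `ι` is the velocity reversal. -/
def dv {V : ℝ} (φ : Omega V → ℝ) (p : Omega V) : ℝ := φ (flip p) - φ p

/-- The class `C^{1,0}`: continuous functions whose derivative in `x` exists everywhere and is
continuous. -/
structure IsC10 {V : ℝ} (φ : Omega V → ℝ) : Prop where
  continuous : Continuous φ
  differentiable : ∀ p : Omega V,
    DifferentiableAt ℝ (fun h : ℝ => φ (p.1 + (h : UnitAddCircle), p.2)) 0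
  continuous_dx : Continuous (dx φ)

/-- The generator `Q φ = v ∂ₓ φ + lam (φ ∘ ι - φ)`. -/
def generator {V : ℝ} (lam : ℝ) (φ : Omega V → ℝ) (p : Omega V) : ℝ :=
  (p.2 : ℝ) * dx φ p + lam * dv φ p

/-- `C([0,T]; 𝒫(Ω))`, where `𝒫(Ω)` carries the narrow topology. -/
abbrev Curve (V T : ℝ) : Type := C(Set.Icc (0 : ℝ) T, ProbabilityMeasure (Omega V))

/-- The time slice `σ_r`, as a function of a real time `r` (only times in `[0,T]` matter: outside
`[0,T]` the curve is extended by its end values). -/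
def slice {V T : ℝ} (hT : 0 ≤ T) (σ : Curve V T) (r : ℝ) : ProbabilityMeasure (Omega V) :=
  Set.IccExtend hT σ r

/-- Weak solutions of `∂ₜ σ + v ∂ₓ σ = lam (ι_♯ σ - σ)`, `σ|_{t=0} = σ₀`. -/
def IsWeakSolution {V T : ℝ} (lam : ℝ) (hT : 0 ≤ T) (σ₀ : ProbabilityMeasure (Omega V))
    (σ : Curve V T) : Prop :=
  slice hT σ 0 = σ₀ ∧
  ∀ φ : Omega V → ℝ, IsC10 φ → ∀ s t : ℝ, 0 ≤ s → s ≤ t → t ≤ T →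
    ∫ p, φ p ∂(slice hT σ t : Measure (Omega V)) - ∫ p, φ p ∂(slice hT σ s : Measure (Omega V))
      = ∫ r in s..t, ∫ p, generator lam φ p ∂(slice hT σ r : Measure (Omega V))

/-- `ℳ(Ω; ℝ²)`: pairs of finite signed Borel measures. -/
abbrev Flux (V : ℝ) : Type := SignedMeasure (Omega V) × SignedMeasure (Omega V)

/-- The pairing `⟨(φ₁, φ₂), j⟩ = ∫ φ₁ dj¹ + ∫ φ₂ dj²`. -/
def pairing {V : ℝ} (φ₁ φ₂ : Omega V → ℝ) (j : Flux V) : ℝ :=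
  (∫ᵛ p, φ₁ p ∂<•j.1) + ∫ᵛ p, φ₂ p ∂<•j.2

/-- The total-variation norm on `ℳ(Ω; ℝ²)`: the supremum of `⟨φ, j⟩` over continuous
`φ = (φ₁, φ₂)` with `|φᵢ| ≤ 1`. (Since `φ = 0` is admissible, taking positive parts does not
change the supremum.) -/
def tvNorm {V : ℝ} (j : Flux V) : ℝ≥0∞ :=
  ⨆ φ : {φ : C(Omega V, ℝ) × C(Omega V, ℝ) // ∀ p, |φ.1 p| ≤ 1 ∧ |φ.2 p| ≤ 1},
    ENNReal.ofReal (pairing φ.1.1 φ.1.2 j)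

/-- The continuity equation `(σ, j) ∈ CE(0,T;Ω)`. The flux is a family indexed by `t ∈ (0,T)`;
the values of `j` at other times play no role. -/
structure ContinuityEquation {V T : ℝ} (hT : 0 ≤ T) (σ : Curve V T) (j : ℝ → Flux V) : Prop where
  measurable_fst : ∀ B : Set (Omega V), MeasurableSet B →
    Measurable fun t : Set.Ioo (0 : ℝ) T => (j t).1 B
  measurable_snd : ∀ B : Set (Omega V), MeasurableSet B →
    Measurable fun t : Set.Ioo (0 : ℝ) T => (j t).2 B
  tv_finite : ∫⁻ t in Set.Ioo (0 : ℝ) T, tvNorm (j t) < ∞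
  weak : ∀ φ : Omega V → ℝ, IsC10 φ → ∀ s t : ℝ, 0 ≤ s → s ≤ t → t ≤ T →
    ∫ p, φ p ∂(slice hT σ t : Measure (Omega V)) - ∫ p, φ p ∂(slice hT σ s : Measure (Omega V))
      = ∫ r in s..t, pairing (dx φ) (dv φ) (j r)

/-- The Hamiltonian `ℋ(σ, φ) = ∫ [v φ₁ + lam (exp φ₂ - 1)] dσ`. -/
def hamiltonian {V : ℝ} (lam : ℝ) (σ : ProbabilityMeasure (Omega V)) (φ₁ φ₂ : Omega V → ℝ) : ℝ :=
  ∫ p, ((p.2 : ℝ) * φ₁ p + lam * (Real.exp (φ₂ p) - 1)) ∂(σ : Measure (Omega V))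

/-- The Lagrangian, the Legendre dual of the Hamiltonian: the supremum of `⟨φ, j⟩ - ℋ(σ, φ)` over
continuous `φ = (φ₁, φ₂)`, with values in `[0, ∞]`. (Since `φ = 0` gives the value `0`, taking
positive parts does not change the supremum.) -/
def lagrangian {V : ℝ} (lam : ℝ) (σ : ProbabilityMeasure (Omega V)) (j : Flux V) : ℝ≥0∞ :=
  ⨆ φ : C(Omega V, ℝ) × C(Omega V, ℝ),
    ENNReal.ofReal (pairing φ.1 φ.2 j - hamiltonian lam σ φ.1 φ.2)

open Classical in
/-- The rate functional `ℐ(σ, j)`. -/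
def rate {V T : ℝ} (lam : ℝ) (hT : 0 ≤ T) (σ : Curve V T) (j : ℝ → Flux V) : ℝ≥0∞ :=
  if ContinuityEquation hT σ j then
    ∫⁻ t in Set.Ioo (0 : ℝ) T, lagrangian lam (slice hT σ t) (j t)
  else ∞

open Classical in
/-- The relative entropy of finite measures: `∫ (f log f - f + 1) dν` with `f = dμ/dν` if `μ ≪ ν`,
and `+∞` otherwise. -/
def relEnt {V : ℝ} (μ ν : Measure (Omega V)) : ℝ≥0∞ :=
  if μ ≪ ν then
    ∫⁻ p, ENNReal.ofReal ((μ.rnDeriv ν p).toReal * Real.log (μ.rnDeriv ν p).toReal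
      - (μ.rnDeriv ν p).toReal + 1) ∂ν
  else ∞

/-- For finite measures the relative entropy is Mathlib's Kullback-Leibler divergence. -/
theorem relEnt_eq_klDiv {V : ℝ} (μ ν : Measure (Omega V)) [IsFiniteMeasure μ]
    [IsFiniteMeasure ν] : relEnt μ ν = InformationTheory.klDiv μ ν := by
  rw [InformationTheory.klDiv_eq_lintegral_klFun, relEnt]
  congr 1
  refine lintegral_congr fun p => ?_
  congr 1
  simp only [InformationTheory.klFun]
  ring

/-- Variational solutions: zeros of `Ent(σ|_{t=0} | σ₀) + ℐ(σ, j)` for some flux `j`. -/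
def IsVariationalSolution {V T : ℝ} (lam : ℝ) (hT : 0 ≤ T) (σ₀ : ProbabilityMeasure (Omega V))
    (σ : Curve V T) : Prop :=
  ∃ j : ℝ → Flux V, ContinuityEquation hT σ j ∧
    relEnt (slice hT σ 0 : Measure (Omega V)) (σ₀ : Measure (Omega V)) + rate lam hT σ j = 0

end

end Kac

/-!
*Existence.* In the frame moving with the free transport `S_t (x, v) = (x + vt, v)`, the Kac
equation becomes the pure jump equation `ν_t' = lam (K_t)_♯ ν_t` (after multiplication by
`exp (lam t)`), where `K_t = S_{-t} ∘ ι ∘ S_t`. Its solution is the Dyson series `dyson`, built out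
of kernels, so that positivity and measurability in time come for free and the total mass
`exp (lam t)` is an exponential series. Fubini's theorem turns the series into Duhamel's formula
against moving observables (`integral_dyson_duhamel`); for the observable
`exp (-lam t) • φ ∘ S_t` with `φ` of class `C^{1,0}` it is the weak formulation
(`integral_kacLaw_eq`).

*Uniqueness.* Since `v ^ 2` is constant, the functions `e^{2πinx}` and `e^{2πinx} v` span, for each
`n`, a space invariant under the generator, so the two moments `∫ e^{2πinx} dσ_t` and
`∫ e^{2πinx} v dσ_t` of a weak solution solve a linear ordinary differential equation
(`IsWeakSolution.moments_eq`) and are determined by the initial datum. The monomials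
`e^{2πinx} v^k` span a star algebra separating points, so these moments determine the measure
(`eq_of_integral_monomial_eq`). The same algebra, with the compactness of the state space, reduces
the narrow continuity of the constructed curve to `C^{1,0}` observables (`kacCurve`).

*Variational characterisation.* The flux `(v σ, lam σ)` has zero cost because `x ≤ exp x - 1`, and
it turns the weak formulation into the continuity equation. Conversely, if the cost of `j`
vanishes, then for a fixed test pair `φ` and almost every time, `⟨φ / n, j_t⟩ ≤ ℋ(σ_t, φ / n)` for
all `n`; multiplying by `n` and letting `n → ∞` gives `⟨φ, j_t⟩ ≤ ∫ (v φ₁ + lam φ₂) dσ_t`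
(`ae_pairing_le_integral`), and `-φ` gives the reverse inequality. Only the test pair
`(∂ₓ φ, φ ∘ ι - φ)` of the continuity equation is needed, so `j` itself is not identified.
-/

namespace Kac

open MeasureTheory Set Filter Topology ProbabilityTheory Function

noncomputable section

/-! ### The Dyson series of a jump process -/

section Series

variable {X : Type*} [MeasurableSpace X]

/-- The kernel `t ↦ lam • ds|_{(0, t]}` on `ℝ`; composing with it on the right is integration in
time from `0` to `t`. -/
def timeKernel (lam : ℝ) : Kernel ℝ ℝ :=
  Kernel.withDensity (Kernel.const ℝ volume)
    fun t s => (Ioc 0 t).indicator (fun _ => ENNReal.ofReal lam) s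

theorem timeKernel_apply (lam t : ℝ) :
    timeKernel lam t = ENNReal.ofReal lam • volume.restrict (Ioc 0 t) := by
  rw [timeKernel, Kernel.withDensity_apply]
  · rw [Kernel.const_apply, withDensity_indicator measurableSet_Ioc, withDensity_const]
  · refine (measurable_const (a := ENNReal.ofReal lam)).indicator
      (s := {q : ℝ × ℝ | 0 < q.2 ∧ q.2 ≤ q.1}) ?_
    exact (measurableSet_lt measurable_const measurable_snd).inter
      (measurableSet_le measurable_snd measurable_fst)

instance (lam : ℝ) : IsSFiniteKernel (timeKernel lam) :=
  Kernel.IsSFiniteKernel.withDensity _ fun t s => by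
    by_cases h : s ∈ Ioc 0 t <;> simp [h]

instance (lam t : ℝ) : IsFiniteMeasure (timeKernel lam t) := by
  rw [timeKernel_apply]
  exact Measure.smul_finite _ ENNReal.ofReal_ne_top

/-- Integrals against `timeKernel` are interval integrals. -/
theorem integral_timeKernel {lam t : ℝ} (hlam : 0 ≤ lam) (ht : 0 ≤ t) (f : ℝ → ℝ) :
    ∫ s, f s ∂timeKernel lam t = lam * ∫ s in (0 : ℝ)..t, f s := by
  rw [timeKernel_apply, integral_smul_measure, intervalIntegral.integral_of_le ht,
    ENNReal.toReal_ofReal hlam, smul_eq_mul]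

/-- The image `s ↦ (K s)_♯ (κ s)` of a family of measures under a family of jump maps. -/
def jumpKernel (K : ℝ → X → X) (κ : Kernel ℝ X) : Kernel ℝ X :=
  (Kernel.id ×ₖ κ).map (uncurry K)

instance (K : ℝ → X → X) (κ : Kernel ℝ X) : IsSFiniteKernel (jumpKernel K κ) := by
  unfold jumpKernel
  infer_instance

theorem jumpKernel_apply {K : ℝ → X → X} (hK : Measurable (uncurry K)) (κ : Kernel ℝ X)
    [IsSFiniteKernel κ] (s : ℝ) : jumpKernel K κ s = (κ s).map (K s) := by
  rw [jumpKernel, Kernel.map_apply _ hK, Kernel.prod_apply, Kernel.id_apply, Measure.dirac_prod,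
    Measure.map_map hK (by fun_prop)]
  rfl

/-- The terms of the Dyson series `∑ₙ lamⁿ ∫_{0<s₁<⋯<sₙ≤t} (K_{sₙ} ∘ ⋯ ∘ K_{s₁})_♯ μ ds`: the `n`-th
term is the contribution of the paths with exactly `n` jumps before time `t`. -/
def dysonTerm (K : ℝ → X → X) (lam : ℝ) (μ : Measure X) : ℕ → Kernel ℝ X
  | 0 => Kernel.const ℝ μ
  | n + 1 => jumpKernel K (dysonTerm K lam μ n) ∘ₖ timeKernel lam

instance (K : ℝ → X → X) (lam : ℝ) (μ : Measure X) [SFinite μ] (n : ℕ) :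
    IsSFiniteKernel (dysonTerm K lam μ n) := by
  cases n <;> (unfold dysonTerm; infer_instance)

/-- The Dyson series, which solves `ν_t = μ + lam ∫_0^t (K_s)_♯ ν_s ds`. -/
def dyson (K : ℝ → X → X) (lam : ℝ) (μ : Measure X) : Kernel ℝ X :=
  Kernel.sum (dysonTerm K lam μ)

instance (K : ℝ → X → X) (lam : ℝ) (μ : Measure X) [SFinite μ] :
    IsSFiniteKernel (dyson K lam μ) := by
  unfold dyson
  infer_instance

theorem dyson_eq {K : ℝ → X → X} (hK : Measurable (uncurry K)) (lam : ℝ) (μ : Measure X)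
    [SFinite μ] (t : ℝ) :
    dyson K lam μ t = μ + (jumpKernel K (dyson K lam μ) ∘ₖ timeKernel lam) t := by
  ext B hB
  have hKs : ∀ s, Measurable (K s) := fun s => hK.comp measurable_prodMk_left
  have h1 : ∀ s, jumpKernel K (dyson K lam μ) s B
      = ∑' n, jumpKernel K (dysonTerm K lam μ n) s B := by
    intro s
    rw [jumpKernel_apply hK, Measure.map_apply (hKs s) hB, dyson,
      Kernel.sum_apply' _ _ (hKs s hB)]
    refine tsum_congr fun n => ?_
    rw [jumpKernel_apply hK, Measure.map_apply (hKs s) hB]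
  rw [Measure.add_apply, Kernel.comp_apply' _ _ _ hB, lintegral_congr h1,
    lintegral_tsum fun n => (Kernel.measurable_coe _ hB).aemeasurable, dyson,
    Kernel.sum_apply' _ _ hB, tsum_eq_zero_add' ENNReal.summable]
  congr 1
  refine tsum_congr fun n => ?_
  rw [dysonTerm, Kernel.comp_apply' _ _ _ hB]

theorem dysonTerm_univ {K : ℝ → X → X} (hK : Measurable (uncurry K)) {lam : ℝ} (hlam : 0 ≤ lam)
    (μ : Measure X) [IsProbabilityMeasure μ] (n : ℕ) {t : ℝ} (ht : 0 ≤ t) :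
    dysonTerm K lam μ n t univ = ENNReal.ofReal ((lam * t) ^ n / n.factorial) := by
  induction n generalizing t with
  | zero => simp [dysonTerm]
  | succ n ih =>
    have hKs : ∀ s, Measurable (K s) := fun s => hK.comp measurable_prodMk_left
    have h1 : ∀ s ∈ Ioc 0 t, jumpKernel K (dysonTerm K lam μ n) s univ
        = ENNReal.ofReal ((lam * s) ^ n / n.factorial) := by
      intro s hs
      rw [jumpKernel_apply hK, Measure.map_apply (hKs s) MeasurableSet.univ, preimage_univ,
        ih hs.1.le]
    rw [dysonTerm, Kernel.comp_apply' _ _ _ MeasurableSet.univ, timeKernel_apply,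
      lintegral_smul_measure, setLIntegral_congr_fun measurableSet_Ioc h1,
      ← ofReal_integral_eq_lintegral_ofReal, ← intervalIntegral.integral_of_le ht, smul_eq_mul,
      ← ENNReal.ofReal_mul hlam]
    · congr 1
      simp_rw [mul_pow, mul_div_right_comm]
      rw [intervalIntegral.integral_const_mul, integral_pow, Nat.factorial_succ]
      have : (n.factorial : ℝ) ≠ 0 := by positivity
      push_cast
      field_simp
      ring
    · have hc : Continuous fun s : ℝ => (lam * s) ^ n / (n.factorial : ℝ) := by fun_prop
      exact (hc.integrableOn_Icc (a := 0) (b := t)).mono_set Ioc_subset_Icc_self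
    · refine (ae_restrict_iff' measurableSet_Ioc).2 (.of_forall fun s hs => ?_)
      have := hs.1.le
      positivity

theorem dyson_univ {K : ℝ → X → X} (hK : Measurable (uncurry K)) {lam : ℝ} (hlam : 0 ≤ lam)
    (μ : Measure X) [IsProbabilityMeasure μ] {t : ℝ} (ht : 0 ≤ t) :
    dyson K lam μ t univ = ENNReal.ofReal (Real.exp (lam * t)) := by
  rw [dyson, Kernel.sum_apply' _ _ MeasurableSet.univ]
  simp_rw [dysonTerm_univ hK hlam μ _ ht]
  rw [← ENNReal.ofReal_tsum_of_nonneg (fun n => by positivity) (Real.summable_pow_div_factorial _),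
    Real.exp_eq_exp_ℝ, NormedSpace.exp_eq_tsum_div]

theorem isFiniteMeasure_dyson {K : ℝ → X → X} (hK : Measurable (uncurry K)) {lam : ℝ}
    (hlam : 0 ≤ lam) (μ : Measure X) [IsProbabilityMeasure μ] {t : ℝ} (ht : 0 ≤ t) :
    IsFiniteMeasure (dyson K lam μ t) :=
  ⟨by rw [dyson_univ hK hlam μ ht]; exact ENNReal.ofReal_lt_top⟩

/-- The compositional product here is a measure on pairs (time, position): up to normalisation, the
law of the last jump before time `t`. -/
theorem dyson_eq_snd {K : ℝ → X → X} (hK : Measurable (uncurry K)) (lam : ℝ) (μ : Measure X)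
    [SFinite μ] (t : ℝ) :
    dyson K lam μ t = μ + (timeKernel lam t ⊗ₘ jumpKernel K (dyson K lam μ)).snd := by
  rw [Measure.snd_compProd, dyson_eq hK, Kernel.comp_apply]

theorem isFiniteMeasure_compProd {K : ℝ → X → X} (hK : Measurable (uncurry K)) {lam : ℝ}
    (hlam : 0 ≤ lam) (μ : Measure X) [IsProbabilityMeasure μ] {t : ℝ} (ht : 0 ≤ t) :
    IsFiniteMeasure (timeKernel lam t ⊗ₘ jumpKernel K (dyson K lam μ)) := by
  have := isFiniteMeasure_dyson hK hlam μ ht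
  constructor
  rw [← Measure.snd_univ]
  refine lt_of_le_of_lt ?_ (measure_lt_top (dyson K lam μ t) univ)
  rw [dyson_eq_snd hK, Measure.add_apply]
  exact le_add_self

theorem ae_fst_mem_Ioc (K : ℝ → X → X) (lam : ℝ) (μ : Measure X) [SFinite μ] (t : ℝ) :
    ∀ᵐ z ∂(timeKernel lam t ⊗ₘ jumpKernel K (dyson K lam μ)), z.1 ∈ Ioc 0 t := by
  refine Measure.ae_compProd_of_ae_ae (measurable_fst measurableSet_Ioc) ?_
  rw [timeKernel_apply]
  exact Measure.ae_smul_measure ((ae_restrict_mem measurableSet_Ioc).mono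
    fun s hs => .of_forall fun _ => hs) _

theorem integrable_compProd_jumpKernel {K : ℝ → X → X} (hK : Measurable (uncurry K)) {lam : ℝ}
    (hlam : 0 ≤ lam) (μ : Measure X) [IsProbabilityMeasure μ] {t : ℝ} (ht : 0 ≤ t)
    {f : ℝ → X → ℝ} (hf : Measurable (uncurry f)) {C : ℝ}
    (hC : ∀ s ∈ Ioc 0 t, ∀ q, |f s q| ≤ C) :
    Integrable (fun z => f z.1 z.2) (timeKernel lam t ⊗ₘ jumpKernel K (dyson K lam μ)) := by
  have := isFiniteMeasure_compProd hK hlam μ ht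
  exact .of_bound hf.aestronglyMeasurable C
    ((ae_fst_mem_Ioc K lam μ t).mono fun z hz => hC z.1 hz z.2)

theorem integral_compProd_jumpKernel {K : ℝ → X → X} (hK : Measurable (uncurry K)) {lam : ℝ}
    (hlam : 0 ≤ lam) (μ : Measure X) [IsProbabilityMeasure μ] {t : ℝ} (ht : 0 ≤ t)
    {f : ℝ → X → ℝ} (hf : Measurable (uncurry f)) {C : ℝ}
    (hC : ∀ s ∈ Ioc 0 t, ∀ q, |f s q| ≤ C) :
    ∫ z, f z.1 z.2 ∂(timeKernel lam t ⊗ₘ jumpKernel K (dyson K lam μ))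
      = lam * ∫ s in (0 : ℝ)..t, ∫ p, f s (K s p) ∂dyson K lam μ s := by
  have := isFiniteMeasure_compProd hK hlam μ ht
  rw [Measure.integral_compProd (integrable_compProd_jumpKernel hK hlam μ ht hf hC),
    integral_timeKernel hlam ht]
  refine congrArg _ (intervalIntegral.integral_congr fun s _ => ?_)
  have hfs : Measurable (f s) := hf.comp measurable_prodMk_left
  have hKs : Measurable (K s) := hK.comp measurable_prodMk_left
  simp only
  rw [jumpKernel_apply hK, integral_map hKs.aemeasurable hfs.aestronglyMeasurable]

/-- **Duhamel's formula** for the Dyson series, tested against an observable `ψ` moving in time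
with velocity `χ`. It follows from Fubini's theorem for the law of the last jump. -/
theorem integral_dyson_duhamel {K : ℝ → X → X} (hK : Measurable (uncurry K)) {lam : ℝ}
    (hlam : 0 ≤ lam) (μ : Measure X) [IsProbabilityMeasure μ] {t : ℝ} (ht : 0 ≤ t)
    {ψ χ : ℝ → X → ℝ} (hψ : Measurable (uncurry ψ)) (hχ : Measurable (uncurry χ)) {C : ℝ}
    (hCψ : ∀ s ∈ Icc 0 t, ∀ q, |ψ s q| ≤ C) (hCχ : ∀ s ∈ Icc 0 t, ∀ q, |χ s q| ≤ C)
    (h : ∀ s ∈ Icc 0 t, ∀ q, ψ t q = ψ s q + ∫ u in s..t, χ u q) :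
    ∫ q, ψ t q ∂dyson K lam μ t = ∫ q, ψ 0 q ∂μ
      + (∫ u in (0 : ℝ)..t, ∫ q, χ u q ∂dyson K lam μ u)
      + lam * ∫ s in (0 : ℝ)..t, ∫ p, ψ s (K s p) ∂dyson K lam μ s := by
  set M : ℝ → Measure (ℝ × X) := fun u => timeKernel lam u ⊗ₘ jumpKernel K (dyson K lam μ)
    with hM
  have hMfin : ∀ u, 0 ≤ u → IsFiniteMeasure (M u) := fun u hu =>
    isFiniteMeasure_compProd hK hlam μ hu
  have hψs : ∀ s, Measurable (ψ s) := fun s => hψ.comp measurable_prodMk_left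
  have hχs : ∀ s, Measurable (χ s) := fun s => hχ.comp measurable_prodMk_left
  have := hMfin t ht
  have hC : 0 ≤ C := by
    have : Nonempty X := μ.nonempty_of_neZero
    exact (abs_nonneg _).trans (hCψ 0 ⟨le_rfl, ht⟩ (Classical.arbitrary X))
  -- integrals against the series split into the part without jumps and the last-jump part
  have split : ∀ u ∈ Icc 0 t, ∀ g : X → ℝ, Measurable g → (∀ q, |g q| ≤ C) →
      ∫ q, g q ∂dyson K lam μ u = ∫ q, g q ∂μ + ∫ z, g z.2 ∂M u := by
    intro u hu g hg hgC
    have := hMfin u hu.1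
    have h1 : ∀ ρ : Measure X, IsFiniteMeasure ρ → Integrable g ρ := fun ρ _ =>
      .of_bound hg.aestronglyMeasurable C (.of_forall hgC)
    have h2 : IsFiniteMeasure (M u).snd := inferInstance
    rw [dyson_eq_snd hK, integral_add_measure (h1 _ inferInstance) (h1 _ h2), Measure.snd,
      integral_map measurable_snd.aemeasurable hg.aestronglyMeasurable]
  have hχ' : Measurable fun z : X × ℝ => χ z.2 z.1 := hχ.comp measurable_swap
  have ae1 : ∀ᵐ z ∂(μ.prod (volume.restrict (Ioc 0 t))), z.2 ∈ Ioc 0 t :=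
    Measure.quasiMeasurePreserving_snd.ae (ae_restrict_mem measurableSet_Ioc)
  -- the part without jumps
  have int1 : Integrable (uncurry fun q u => χ u q) (μ.prod (volume.restrict (Ioc 0 t))) :=
    .of_bound hχ'.aestronglyMeasurable C (ae1.mono fun z hz =>
      hCχ z.2 (Ioc_subset_Icc_self hz) z.1)
  have part1 : ∫ q, ψ t q ∂μ = ∫ q, ψ 0 q ∂μ + ∫ u in Ioc 0 t, ∫ q, χ u q ∂μ := by
    rw [← integral_integral_swap int1, ← integral_add]
    · refine integral_congr_ae (.of_forall fun q => ?_)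
      simp only
      rw [h 0 ⟨le_rfl, ht⟩ q, intervalIntegral.integral_of_le ht]
    · exact .of_bound (hψs 0).aestronglyMeasurable C
        (.of_forall (hCψ 0 ⟨le_rfl, ht⟩))
    · exact int1.integral_prod_left
  -- the part with a last jump, where `ψ` is moved from the jump time `z.1` to `t`
  let G : ℝ × X → ℝ → ℝ := fun z u => {w : (ℝ × X) × ℝ | w.1.1 < w.2}.indicator
    (fun w => χ w.2 w.1.2) (z, u)
  have hGset : MeasurableSet {w : (ℝ × X) × ℝ | w.1.1 < w.2} :=
    measurableSet_lt (by fun_prop) (by fun_prop)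
  have hG : Measurable (uncurry G) := by
    refine Measurable.indicator ?_ hGset
    exact hχ.comp (f := fun w : (ℝ × X) × ℝ => (w.2, w.1.2)) (by fun_prop)
  have int2 : Integrable (uncurry G) ((M t).prod (volume.restrict (Ioc 0 t))) := by
    refine .of_bound hG.aestronglyMeasurable C ?_
    filter_upwards [Measure.quasiMeasurePreserving_snd.ae (ae_restrict_mem measurableSet_Ioc)]
      with w hw
    by_cases h' : w.1.1 < w.2
    · simpa [G, uncurry, indicator, h'] using hCχ w.2 (Ioc_subset_Icc_self hw) w.1.2
    · simpa [G, uncurry, indicator, h'] using hC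
  have part2 : ∫ z, ψ t z.2 ∂M t = ∫ z, ψ z.1 z.2 ∂M t
      + ∫ u in Ioc 0 t, ∫ z, G z u ∂M t := by
    rw [← integral_integral_swap int2, ← integral_add]
    · refine integral_congr_ae ?_
      filter_upwards [ae_fst_mem_Ioc K lam μ t] with z hz
      rw [h z.1 (Ioc_subset_Icc_self hz) z.2, intervalIntegral.integral_of_le hz.2]
      congr 1
      have : ∀ u, G z u = (Ioi z.1).indicator (fun u => χ u z.2) u := fun u => rfl
      simp_rw [this]
      rw [setIntegral_indicator measurableSet_Ioi]
      congr 2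
      ext u
      simp only [mem_inter_iff, mem_Ioc, mem_Ioi]
      exact ⟨fun hu => ⟨⟨hz.1.trans hu.1, hu.2⟩, hu.1⟩, fun hu => ⟨hu.2, hu.1.2⟩⟩
    · exact integrable_compProd_jumpKernel hK hlam μ ht hψ
        fun s hs => hCψ s (Ioc_subset_Icc_self hs)
    · exact int2.integral_prod_left
  -- restricting the last-jump measure at time `t` to jump times before `u` gives the last-jump
  -- measure at time `u`
  have part3 : ∀ u ∈ Ioc 0 t, ∫ z, G z u ∂M t = ∫ z, χ u z.2 ∂M u := by
    intro u hu
    have e1 := integral_compProd_jumpKernel hK hlam μ ht (f := fun s q => G (s, q) u)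
      (hG.comp (measurable_id.prodMk measurable_const)) (C := C) fun s hs q => by
        by_cases h' : s < u
        · simpa [G, indicator, h'] using hCχ u (Ioc_subset_Icc_self hu) q
        · simpa [G, indicator, h'] using hC
    have e2 := integral_compProd_jumpKernel hK hlam μ hu.1.le (f := fun _ q => χ u q)
      ((hχs u).comp measurable_snd) (C := C) fun s hs q => hCχ u (Ioc_subset_Icc_self hu) q
    simp only [Prod.mk.eta] at e1
    rw [hM]
    simp only
    rw [e1, e2, intervalIntegral.integral_of_le ht, intervalIntegral.integral_of_le hu.1.le]
    congr 1
    have : ∀ s, ∫ p, G (s, K s p) u ∂dyson K lam μ s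
        = (Iio u).indicator (fun s => ∫ p, χ u (K s p) ∂dyson K lam μ s) s := by
      intro s
      by_cases h' : s < u <;> simp [G, indicator, h']
    simp_rw [this]
    rw [setIntegral_indicator measurableSet_Iio, integral_Ioc_eq_integral_Ioo]
    congr 2
    ext s
    simp only [mem_inter_iff, mem_Ioc, mem_Iio, mem_Ioo]
    exact ⟨fun hs => ⟨hs.1.1, hs.2⟩, fun hs => ⟨⟨hs.1, hs.2.le.trans hu.2⟩, hs.2⟩⟩
  rw [split t ⟨ht, le_rfl⟩ _ (hψs t) (hCψ t ⟨ht, le_rfl⟩), part1, part2,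
    ← integral_compProd_jumpKernel hK hlam μ ht hψ fun s hs => hCψ s (Ioc_subset_Icc_self hs),
    intervalIntegral.integral_of_le ht]
  have part4 : ∫ u in Ioc 0 t, ∫ q, χ u q ∂dyson K lam μ u
      = (∫ u in Ioc 0 t, ∫ q, χ u q ∂μ) + ∫ u in Ioc 0 t, ∫ z, G z u ∂M t := by
    have j1 : Integrable (fun u => ∫ q, χ u q ∂μ) (volume.restrict (Ioc 0 t)) :=
      int1.integral_prod_right
    have j2 : Integrable (fun u => ∫ z, G z u ∂M t) (volume.restrict (Ioc 0 t)) :=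
      int2.integral_prod_right
    rw [← integral_add j1 j2]
    refine setIntegral_congr_fun measurableSet_Ioc fun u hu => ?_
    rw [part3 u hu]
    exact split u (Ioc_subset_Icc_self hu) _ (hχs u) (hCχ u (Ioc_subset_Icc_self hu))
  rw [part4]
  ring

end Series

/-! ### Trigonometric polynomials on the state space -/

section Trig

open BoundedContinuousFunction

variable {V : ℝ}

theorem sq_velocity (p : Omega V) : (p.2 : ℝ) ^ 2 = V ^ 2 := by
  rcases p.2.2 with h | h
  · rw [h, neg_sq]
  · rw [Set.mem_singleton_iff.mp h]

theorem abs_velocity (hV : 0 < V) (p : Omega V) : |(p.2 : ℝ)| = V :=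
  ((sq_eq_sq_iff_abs_eq_abs _ _).1 (sq_velocity p)).trans (abs_of_pos hV)

@[fun_prop]
theorem continuous_velocity : Continuous fun p : Omega V => (p.2 : ℝ) :=
  continuous_subtype_val.comp continuous_snd

@[fun_prop]
theorem continuous_flip : Continuous (flip : Omega V → Omega V) :=
  continuous_fst.prodMk (Continuous.subtype_mk (continuous_velocity.neg) _)

/-- The monomial `e^{2πinx} v^k` on the state space. -/
def monomial (V : ℝ) (q : ℤ × ℕ) : Omega V →ᵇ ℂ :=
  mkOfCompact ⟨fun p => fourier q.1 p.1 * (p.2 : ℝ) ^ q.2, by fun_prop⟩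

theorem monomial_apply (q : ℤ × ℕ) (p : Omega V) :
    monomial V q p = fourier q.1 p.1 * ((p.2 : ℝ) : ℂ) ^ q.2 := rfl

/-- The monomials form a multiplicative monoid. -/
def monomialMonoid (V : ℝ) : Submonoid (Omega V →ᵇ ℂ) where
  carrier := range (monomial V)
  one_mem' := ⟨(0, 0), by ext p; simp [monomial_apply]⟩
  mul_mem' := by
    rintro _ _ ⟨q, rfl⟩ ⟨q', rfl⟩
    refine ⟨(q.1 + q'.1, q.2 + q'.2), ?_⟩
    ext p
    rw [BoundedContinuousFunction.mul_apply, monomial_apply, monomial_apply, monomial_apply,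
      fourier_add]
    ring

/-- The star algebra spanned by the monomials `e^{2πinx} v^k`. -/
def trigAlgebra (V : ℝ) : StarSubalgebra ℂ (Omega V →ᵇ ℂ) where
  toSubalgebra := Algebra.adjoin ℂ (monomialMonoid V : Set (Omega V →ᵇ ℂ))
  star_mem' := by
    change Algebra.adjoin ℂ (monomialMonoid V : Set (Omega V →ᵇ ℂ)) ≤
      star (Algebra.adjoin ℂ (monomialMonoid V : Set (Omega V →ᵇ ℂ)))
    refine Algebra.adjoin_le ?_
    rintro _ ⟨q, rfl⟩
    refine Algebra.subset_adjoin ⟨(-q.1, q.2), ?_⟩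
    ext p
    simp only [BoundedContinuousFunction.star_apply, monomial_apply, fourier_neg]
    simp

theorem mem_trigAlgebra {g : Omega V →ᵇ ℂ} :
    g ∈ trigAlgebra V ↔ g ∈ Submodule.span ℂ (range (monomial V)) := by
  change g ∈ Subalgebra.toSubmodule (Algebra.adjoin ℂ (monomialMonoid V : Set (Omega V →ᵇ ℂ))) ↔ _
  rw [Algebra.adjoin_eq_span, Submonoid.closure_eq]
  rfl

theorem trigAlgebra_separatesPoints :
    ((trigAlgebra V).map (toContinuousMapStarₐ ℂ)).SeparatesPoints := by
  intro x y hxy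
  have key : ∀ q, monomial V q x ≠ monomial V q y →
      ∃ f ∈ (fun f : C(Omega V, ℂ) => (f : Omega V → ℂ)) ''
        ((trigAlgebra V).map (toContinuousMapStarₐ ℂ) : Set C(Omega V, ℂ)), f x ≠ f y :=
    fun q hq => ⟨_, ⟨_, ⟨monomial V q, Algebra.subset_adjoin ⟨q, rfl⟩, rfl⟩, rfl⟩, hq⟩
  by_cases h : x.1 = y.1
  · refine key (0, 1) fun h' => hxy (Prod.ext h (Subtype.ext ?_))
    simpa [monomial_apply] using h'
  · refine key (1, 0) fun h' => h ?_
    simp only [monomial_apply, fourier_one, pow_zero, mul_one] at h'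
    exact AddCircle.injective_toCircle one_ne_zero (Circle.ext h')

end Trig

/-! ### Uniqueness of weak solutions -/

section Unique

/-- Uniqueness for the bounded linear equation `u' = L u`, `u 0 = 0`, in integrated form. -/
theorem eqOn_zero_of_integral_eq {E : Type*} [NormedAddCommGroup E] [NormedSpace ℝ E]
    [CompleteSpace E] {T : ℝ} {u : ℝ → E} (hu : Continuous u) (L : E →L[ℝ] E)
    (h : ∀ t ∈ Icc 0 T, u t = ∫ r in (0 : ℝ)..t, L (u r)) : ∀ t ∈ Icc 0 T, u t = 0 := by
  intro t ht
  rw [h t ht]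
  refine eq_zero_of_abs_deriv_le_mul_abs_self_of_eq_zero_right (a := 0) (b := T) (K := ‖L‖)
    (f := fun t => ∫ r in (0 : ℝ)..t, L (u r)) (f' := fun t => L (u t))
    ?_ ?_ (by simp) ?_ t ht
  · exact (intervalIntegral.continuous_primitive
      (fun a b => (L.continuous.comp hu).intervalIntegrable a b) 0).continuousOn
  · intro x _
    exact ((L.continuous.comp hu).integral_hasStrictDerivAt 0 x).hasDerivAt.hasDerivWithinAt
  · intro x hx
    rw [← h x (Ico_subset_Icc_self hx)]
    exact L.le_opNorm _

variable {V T lam : ℝ}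

theorem continuous_slice (hT : 0 ≤ T) (σ : Curve V T) : Continuous (slice hT σ) :=
  σ.continuous.Icc_extend'

theorem continuous_integral_slice (hT : 0 ≤ T) (σ : Curve V T) {f : Omega V → ℝ}
    (hf : Continuous f) : Continuous fun t => ∫ p, f p ∂(slice hT σ t : Measure (Omega V)) := by
  rw [continuous_iff_continuousAt]
  intro t
  exact (ProbabilityMeasure.tendsto_iff_forall_integral_tendsto.1
    (continuous_slice hT σ).continuousAt) (BoundedContinuousFunction.mkOfCompact ⟨f, hf⟩)

theorem continuous_integral_slice_complex (hT : 0 ≤ T) (σ : Curve V T) {f : Omega V → ℂ}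
    (hf : Continuous f) : Continuous fun t => ∫ p, f p ∂(slice hT σ t : Measure (Omega V)) := by
  rw [continuous_iff_continuousAt]
  intro t
  exact ((ProbabilityMeasure.tendsto_iff_forall_integral_rclike_tendsto ℂ).1
    (continuous_slice hT σ).continuousAt) (BoundedContinuousFunction.mkOfCompact ⟨f, hf⟩)

theorem integrable_of_continuous {E : Type*} [NormedAddCommGroup E] [SecondCountableTopology E]
    {f : Omega V → E} (hf : Continuous f) (μ : Measure (Omega V)) [IsFiniteMeasure μ] :
    Integrable f μ :=
  hf.integrable_of_hasCompactSupport (.of_compactSpace f)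

theorem isC10_comp {g g' : Omega V → ℂ} (hg : Continuous g) (hg' : Continuous g')
    (hd : ∀ p, HasDerivAt (fun h : ℝ => g (p.1 + (h : UnitAddCircle), p.2)) (g' p) 0)
    (L : ℂ →L[ℝ] ℝ) : IsC10 (fun p => L (g p)) ∧ dx (fun p => L (g p)) = fun p => L (g' p) := by
  have h1 : ∀ p, HasDerivAt (fun h : ℝ => L (g (p.1 + (h : UnitAddCircle), p.2))) (L (g' p)) 0 :=
    fun p => L.hasFDerivAt.comp_hasDerivAt (0 : ℝ) (hd p)
  have h2 : dx (fun p => L (g p)) = fun p => L (g' p) := funext fun p => (h1 p).deriv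
  exact ⟨⟨L.continuous.comp hg, fun p => (h1 p).differentiableAt,
    h2 ▸ L.continuous.comp hg'⟩, h2⟩

/-- The weak formulation for complex-valued observables. -/
theorem IsWeakSolution.integral_complex {hT : 0 ≤ T} {σ₀ : ProbabilityMeasure (Omega V)}
    {σ : Curve V T} (hσ : IsWeakSolution lam hT σ₀ σ) {g g' : Omega V → ℂ} (hg : Continuous g)
    (hg' : Continuous g')
    (hd : ∀ p, HasDerivAt (fun h : ℝ => g (p.1 + (h : UnitAddCircle), p.2)) (g' p) 0)
    {t : ℝ} (ht : t ∈ Icc 0 T) :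
    ∫ p, g p ∂(slice hT σ t : Measure (Omega V)) = ∫ p, g p ∂(σ₀ : Measure (Omega V))
      + ∫ r in (0 : ℝ)..t, ∫ p, ((p.2 : ℝ) : ℂ) * g' p + lam * (g (flip p) - g p)
          ∂(slice hT σ r : Measure (Omega V)) := by
  set Q : Omega V → ℂ := fun p => ((p.2 : ℝ) : ℂ) * g' p + lam * (g (flip p) - g p) with hQ
  have hQc : Continuous Q := by fun_prop
  have key : ∀ L : ℂ →L[ℝ] ℝ, L (∫ p, g p ∂(slice hT σ t : Measure (Omega V)))
      = L (∫ p, g p ∂(σ₀ : Measure (Omega V))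
        + ∫ r in (0 : ℝ)..t, ∫ p, Q p ∂(slice hT σ r : Measure (Omega V))) := by
    intro L
    obtain ⟨h1, h2⟩ := isC10_comp hg hg' hd L
    have h3 := hσ.2 _ h1 0 t le_rfl ht.1 ht.2
    rw [hσ.1, sub_eq_iff_eq_add'] at h3
    have h4 : generator lam (fun p => L (g p)) = fun p => L (Q p) := by
      funext p
      have e1 : Q p = (p.2 : ℝ) • g' p + lam • (g (flip p) - g p) := by simp [hQ]
      rw [e1, generator, h2, dv, map_add, map_smul, map_smul, map_sub, smul_eq_mul, smul_eq_mul]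
    have h5 : ∀ r, ∫ p, L (Q p) ∂(slice hT σ r : Measure (Omega V))
        = L (∫ p, Q p ∂(slice hT σ r : Measure (Omega V))) := fun r =>
      L.integral_comp_comm (integrable_of_continuous hQc _)
    rw [h4] at h3
    simp_rw [h5] at h3
    rw [L.intervalIntegral_comp_comm
      ((continuous_integral_slice_complex hT σ hQc).intervalIntegrable 0 t),
      L.integral_comp_comm (integrable_of_continuous hg _),
      L.integral_comp_comm (integrable_of_continuous hg _)] at h3
    rw [h3, map_add]
  exact Complex.ext (key Complex.reCLM) (key Complex.imCLM)

theorem hasDerivAt_monomial (q : ℤ × ℕ) (p : Omega V) :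
    HasDerivAt (fun h : ℝ => monomial V q (p.1 + (h : UnitAddCircle), p.2))
      (2 * Real.pi * Complex.I * q.1 * monomial V q p) 0 := by
  have h1 := hasDerivAt_fourier (1 : ℝ) q.1 0
  have h2 : ∀ h : ℝ, monomial V q (p.1 + (h : UnitAddCircle), p.2)
      = monomial V q p * fourier q.1 (h : UnitAddCircle) := by
    intro h
    simp only [monomial_apply, fourier_apply, smul_add, AddCircle.toCircle_add, Circle.coe_mul]
    ring
  simp_rw [h2]
  refine (h1.const_mul (monomial V q p)).congr_deriv ?_
  rw [QuotientAddGroup.mk_zero, fourier_eval_zero]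
  push_cast
  ring

theorem monomial_flip (q : ℤ × ℕ) (p : Omega V) :
    monomial V q (flip p) = (-1) ^ q.2 * monomial V q p := by
  have : (((flip p).2 : ℝ) : ℂ) = -((p.2 : ℝ) : ℂ) := by simp [flip]
  rw [monomial_apply, monomial_apply, this, neg_pow]
  simp only [flip]
  ring

/-- The linear system (of telegraph type) satisfied by the pair
`(∫ e^{2πinx} dσ, ∫ e^{2πinx} v dσ)` along a weak solution. -/
def telegraph (V lam : ℝ) (n : ℤ) : ℂ × ℂ →L[ℝ] ℂ × ℂ :=
  (((2 * Real.pi * Complex.I * n : ℂ) • ContinuousLinearMap.snd ℂ ℂ ℂ).prod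
    ((2 * Real.pi * Complex.I * n * V ^ 2 : ℂ) • ContinuousLinearMap.fst ℂ ℂ ℂ
      - (2 * lam : ℂ) • ContinuousLinearMap.snd ℂ ℂ ℂ)).restrictScalars ℝ

theorem telegraph_apply (n : ℤ) (z : ℂ × ℂ) :
    telegraph V lam n z = (2 * Real.pi * Complex.I * n * z.2,
      2 * Real.pi * Complex.I * n * V ^ 2 * z.1 - 2 * lam * z.2) := rfl

/-- The first two velocity moments of the `n`-th Fourier mode. -/
def moments (hT : 0 ≤ T) (σ : Curve V T) (n : ℤ) (t : ℝ) : ℂ × ℂ :=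
  (∫ p, monomial V (n, 0) p ∂(slice hT σ t : Measure (Omega V)),
    ∫ p, monomial V (n, 1) p ∂(slice hT σ t : Measure (Omega V)))

theorem continuous_moments (hT : 0 ≤ T) (σ : Curve V T) (n : ℤ) :
    Continuous (moments hT σ n) :=
  (continuous_integral_slice_complex hT σ (monomial V (n, 0)).continuous).prodMk
    (continuous_integral_slice_complex hT σ (monomial V (n, 1)).continuous)

theorem IsWeakSolution.moments_eq {hT : 0 ≤ T} {σ₀ : ProbabilityMeasure (Omega V)}
    {σ : Curve V T} (hσ : IsWeakSolution lam hT σ₀ σ) (n : ℤ) {t : ℝ} (ht : t ∈ Icc 0 T) :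
    moments hT σ n t = (∫ p, monomial V (n, 0) p ∂(σ₀ : Measure (Omega V)),
        ∫ p, monomial V (n, 1) p ∂(σ₀ : Measure (Omega V)))
      + ∫ r in (0 : ℝ)..t, telegraph V lam n (moments hT σ n r) := by
  have hint : IntervalIntegrable (fun r => telegraph V lam n (moments hT σ n r)) volume 0 t :=
    ((telegraph V lam n).continuous.comp (continuous_moments hT σ n)).intervalIntegrable 0 t
  have hd : ∀ q, Continuous fun p => 2 * Real.pi * Complex.I * q.1 * monomial V q p := fun q =>
    by fun_prop
  have hm : ∀ (q : ℤ × ℕ) (r : ℝ),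
      Integrable (monomial V q) (slice hT σ r : Measure (Omega V)) := fun q r =>
    integrable_of_continuous (monomial V q).continuous _
  refine Prod.ext ?_ ?_
  · have e := hσ.integral_complex (monomial V (n, 0)).continuous (hd _) (hasDerivAt_monomial _) ht
    have e' := (ContinuousLinearMap.fst ℝ ℂ ℂ).intervalIntegral_comp_comm hint
    simp only [ContinuousLinearMap.coe_fst'] at e'
    rw [Prod.fst_add, ← e']
    refine e.trans (congrArg _ (intervalIntegral.integral_congr fun r _ => ?_))
    simp only [telegraph_apply, moments]
    rw [← integral_const_mul]
    refine integral_congr_ae (.of_forall fun p => ?_)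
    simp only [monomial_flip]
    simp only [monomial_apply]
    ring
  · have e := hσ.integral_complex (monomial V (n, 1)).continuous (hd _) (hasDerivAt_monomial _) ht
    have e' := (ContinuousLinearMap.snd ℝ ℂ ℂ).intervalIntegral_comp_comm hint
    simp only [ContinuousLinearMap.coe_snd'] at e'
    rw [Prod.snd_add, ← e']
    refine e.trans (congrArg _ (intervalIntegral.integral_congr fun r _ => ?_))
    simp only [telegraph_apply, moments]
    rw [← integral_const_mul, ← integral_const_mul, ← integral_sub ((hm _ r).const_mul _)
      ((hm _ r).const_mul _)]
    refine integral_congr_ae (.of_forall fun p => ?_)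
    have hv : ((p.2 : ℝ) : ℂ) ^ 2 = (V : ℂ) ^ 2 := by exact_mod_cast sq_velocity p
    simp only [monomial_flip]
    simp only [monomial_apply]
    linear_combination (2 * Real.pi * Complex.I * n * fourier n p.1) * hv

/-- The moments of order `0` and `1` in the velocity determine a measure, since `v ^ 2` is
constant. -/
theorem eq_of_integral_monomial_eq {μ ν : ProbabilityMeasure (Omega V)}
    (h0 : ∀ n : ℤ, ∫ p, monomial V (n, 0) p ∂(μ : Measure (Omega V))
      = ∫ p, monomial V (n, 0) p ∂(ν : Measure (Omega V)))
    (h1 : ∀ n : ℤ, ∫ p, monomial V (n, 1) p ∂(μ : Measure (Omega V))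
      = ∫ p, monomial V (n, 1) p ∂(ν : Measure (Omega V))) : μ = ν := by
  suffices h : (μ : Measure (Omega V)) = ν from Subtype.ext h
  refine ext_of_forall_mem_subalgebra_integral_eq_of_polish (𝕜 := ℂ)
    trigAlgebra_separatesPoints fun g hg => ?_
  have hi : ∀ (g : BoundedContinuousFunction (Omega V) ℂ) (ρ : ProbabilityMeasure (Omega V)),
      Integrable g (ρ : Measure (Omega V)) :=
    fun g ρ => integrable_of_continuous g.continuous _
  have hstep : ∀ (n : ℤ) (k : ℕ) (ρ : ProbabilityMeasure (Omega V)),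
      ∫ p, monomial V (n, k + 2) p ∂(ρ : Measure (Omega V))
        = V ^ 2 * ∫ p, monomial V (n, k) p ∂(ρ : Measure (Omega V)) := by
    intro n k ρ
    rw [← integral_const_mul]
    refine integral_congr_ae (.of_forall fun p => ?_)
    have hv : ((p.2 : ℝ) : ℂ) ^ 2 = (V : ℂ) ^ 2 := by exact_mod_cast sq_velocity p
    simp only [monomial_apply, pow_add, hv]
    ring
  have hmono : ∀ k (n : ℤ), ∫ p, monomial V (n, k) p ∂(μ : Measure (Omega V))
      = ∫ p, monomial V (n, k) p ∂(ν : Measure (Omega V)) := by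
    intro k
    induction k using Nat.twoStepInduction with
    | zero => exact h0
    | one => exact h1
    | more k ih _ =>
      intro n
      rw [hstep, hstep, ih]
  rw [mem_trigAlgebra] at hg
  induction hg using Submodule.span_induction with
  | mem g hg =>
    obtain ⟨q, rfl⟩ := hg
    exact hmono q.2 q.1
  | zero => simp
  | add g g' _ _ ih ih' =>
    simp only [BoundedContinuousFunction.coe_add, Pi.add_apply]
    rw [integral_add (hi _ _) (hi _ _)]
    exact (congrArg₂ _ ih ih').trans (integral_add (hi _ _) (hi _ _)).symm
  | smul c g _ ih =>
    simp only [BoundedContinuousFunction.coe_smul]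
    rw [integral_smul]
    exact (congrArg _ ih).trans (integral_smul _ _).symm

theorem IsWeakSolution.unique {hT : 0 ≤ T} {σ₀ : ProbabilityMeasure (Omega V)}
    {σ σ' : Curve V T} (hσ : IsWeakSolution lam hT σ₀ σ) (hσ' : IsWeakSolution lam hT σ₀ σ') :
    σ = σ' := by
  ext1 t
  have key : ∀ n, moments hT σ n t = moments hT σ' n t := by
    intro n
    refine sub_eq_zero.1 (eqOn_zero_of_integral_eq
      (u := fun r => moments hT σ n r - moments hT σ' n r)
      ((continuous_moments hT σ n).sub (continuous_moments hT σ' n)) (telegraph V lam n)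
      (fun s hs => ?_) t t.2)
    simp only [map_sub]
    rw [intervalIntegral.integral_sub, hσ.moments_eq n hs, hσ'.moments_eq n hs,
      add_sub_add_left_eq_sub]
    · exact ((telegraph V lam n).continuous.comp
        (continuous_moments hT σ n)).intervalIntegrable 0 s
    · exact ((telegraph V lam n).continuous.comp
        (continuous_moments hT σ' n)).intervalIntegrable 0 s
  have hs : ∀ ρ : Curve V T, slice hT ρ t = ρ t := fun ρ => IccExtend_val hT ρ t
  rw [← hs σ, ← hs σ']
  exact eq_of_integral_monomial_eq (fun n => congrArg Prod.fst (key n))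
    fun n => congrArg Prod.snd (key n)

end Unique

/-! ### Existence of a weak solution -/

section Existence

variable {V lam : ℝ}

/-- Free transport `(x, v) ↦ (x + vt, v)`. -/
def transport (t : ℝ) (p : Omega V) : Omega V :=
  (p.1 + (((p.2 : ℝ) * t : ℝ) : UnitAddCircle), p.2)

/-- Velocity reversal at time `s`, seen in the frame moving with the free transport. -/
def jump (s : ℝ) (p : Omega V) : Omega V := transport (-s) (flip (transport s p))

theorem continuous_transport : Continuous (uncurry (transport : ℝ → Omega V → Omega V)) := by
  refine Continuous.prodMk ?_ (continuous_snd.comp continuous_snd)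
  refine (continuous_fst.comp continuous_snd).add ?_
  exact (AddCircle.continuous_mk' 1).comp
    ((continuous_velocity.comp continuous_snd).mul continuous_fst)

theorem continuous_jump : Continuous (uncurry (jump : ℝ → Omega V → Omega V)) :=
  continuous_transport.comp
    (continuous_fst.neg.prodMk (continuous_flip.comp continuous_transport))

theorem transport_zero (p : Omega V) : transport 0 p = p := by
  simp [transport]

theorem transport_jump (s : ℝ) (p : Omega V) : transport s (jump s p) = flip (transport s p) := by
  refine Prod.ext ?_ rfl
  simp [transport, jump, flip]

theorem IsC10.hasDerivAt_transport {φ : Omega V → ℝ} (hφ : IsC10 φ) (q : Omega V) (u : ℝ) :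
    HasDerivAt (fun u => φ (transport u q)) ((q.2 : ℝ) * dx φ (transport u q)) u := by
  have h1 : HasDerivAt (fun h : ℝ => φ ((transport u q).1 + (h : UnitAddCircle), q.2))
      (dx φ (transport u q)) ((q.2 : ℝ) * (u - u)) := by
    rw [sub_self, mul_zero]
    exact (hφ.differentiable (transport u q)).hasDerivAt
  have h2 : HasDerivAt (fun u' : ℝ => (q.2 : ℝ) * (u' - u)) (q.2 : ℝ) u := by
    simpa using ((hasDerivAt_id u).sub_const u).const_mul (q.2 : ℝ)
  have h3 := h1.comp u h2
  rw [mul_comm] at h3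
  refine h3.congr_of_eventuallyEq (.of_forall fun u' => ?_)
  simp only [comp_apply, transport]
  rw [add_assoc, ← QuotientAddGroup.mk_add]
  congr 4
  ring

/-- The law at time `t` of the Kac process started from `μ`: the Dyson series in the moving frame,
normalised and moved back by the free transport. -/
def kacLaw (lam : ℝ) (μ : Measure (Omega V)) (t : ℝ) : Measure (Omega V) :=
  ENNReal.ofReal (Real.exp (-(lam * t))) • (dyson jump lam μ t).map (transport t)

theorem measurable_jump : Measurable (uncurry (jump : ℝ → Omega V → Omega V)) :=
  continuous_jump.measurable

theorem continuous_transport_right (t : ℝ) : Continuous (transport t : Omega V → Omega V) :=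
  continuous_transport.comp (by fun_prop : Continuous fun p : Omega V => (t, p))

theorem isProbabilityMeasure_kacLaw (hlam : 0 ≤ lam) (μ : Measure (Omega V))
    [IsProbabilityMeasure μ] {t : ℝ} (ht : 0 ≤ t) : IsProbabilityMeasure (kacLaw lam μ t) := by
  constructor
  rw [kacLaw, Measure.smul_apply, Measure.map_apply (continuous_transport_right t).measurable
    MeasurableSet.univ, preimage_univ, dyson_univ measurable_jump hlam μ ht, smul_eq_mul,
    ← ENNReal.ofReal_mul (Real.exp_pos _).le, ← Real.exp_add]
  simp

theorem integral_kacLaw (μ : Measure (Omega V)) (t : ℝ) {f : Omega V → ℝ} (hf : Continuous f) :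
    ∫ p, f p ∂kacLaw lam μ t
      = ∫ p, Real.exp (-(lam * t)) * f (transport t p) ∂dyson jump lam μ t := by
  rw [kacLaw, integral_smul_measure, ENNReal.toReal_ofReal (Real.exp_pos _).le,
    integral_map (continuous_transport_right t).aemeasurable hf.aestronglyMeasurable,
    integral_const_mul, smul_eq_mul]

theorem exists_bound {f : Omega V → ℝ} (hf : Continuous f) : ∃ C, ∀ p, |f p| ≤ C := by
  obtain ⟨C, hC⟩ := isCompact_univ.exists_bound_of_continuousOn hf.continuousOn
  exact ⟨C, fun p => hC p (mem_univ p)⟩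

theorem intervalIntegrable_dyson (hlam : 0 ≤ lam) (μ : Measure (Omega V))
    [IsProbabilityMeasure μ] {F : ℝ → Omega V → ℝ} (hF : Continuous (uncurry F)) {t : ℝ}
    (ht : 0 ≤ t) {C : ℝ} (hC : ∀ u ∈ Icc 0 t, ∀ q, |F u q| ≤ C) :
    IntervalIntegrable (fun u => ∫ q, F u q ∂dyson jump lam μ u) volume 0 t := by
  have hC0 : 0 ≤ C := by
    have : Nonempty (Omega V) := μ.nonempty_of_neZero
    exact (abs_nonneg _).trans (hC 0 ⟨le_rfl, ht⟩ (Classical.arbitrary _))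
  rw [intervalIntegrable_iff_integrableOn_Ioc_of_le ht]
  refine Integrable.of_bound (C := C * Real.exp (lam * t))
    (StronglyMeasurable.integral_kernel_prod_right hF.stronglyMeasurable).aestronglyMeasurable
    ((ae_restrict_mem measurableSet_Ioc).mono fun u hu => ?_)
  have := isFiniteMeasure_dyson measurable_jump hlam μ hu.1.le
  refine (norm_integral_le_of_norm_le_const
    (.of_forall (hC u (Ioc_subset_Icc_self hu)))).trans ?_
  rw [measureReal_def, dyson_univ measurable_jump hlam μ hu.1.le,
    ENNReal.toReal_ofReal (Real.exp_pos _).le]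
  gcongr
  exact hu.2

theorem intervalIntegrable_kacLaw (hlam : 0 ≤ lam) (μ : Measure (Omega V))
    [IsProbabilityMeasure μ] {f : Omega V → ℝ} (hf : Continuous f) {t : ℝ} (ht : 0 ≤ t) :
    IntervalIntegrable (fun u => ∫ p, f p ∂kacLaw lam μ u) volume 0 t := by
  simp_rw [fun u => integral_kacLaw (lam := lam) μ u hf]
  obtain ⟨C, hC⟩ := exists_bound hf
  refine intervalIntegrable_dyson hlam μ (F := fun u p => Real.exp (-(lam * u)) * f (transport u p))
    ?_ ht (C := C) fun u hu q => ?_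
  · exact (by fun_prop : Continuous fun z : ℝ × Omega V => Real.exp (-(lam * z.1))).mul
      (hf.comp continuous_transport)
  · rw [abs_mul, Real.abs_exp]
    have : Real.exp (-(lam * u)) ≤ 1 := Real.exp_le_one_iff.2 (by nlinarith [hu.1])
    exact (mul_le_of_le_one_left (abs_nonneg _) this).trans (hC _)

theorem continuous_generator {φ : Omega V → ℝ} (hφ : IsC10 φ) : Continuous (generator lam φ) := by
  have := hφ.continuous
  have := hφ.continuous_dx
  unfold generator dv
  fun_prop

/-- The law of the Kac process satisfies the weak formulation between the times `0` and `t`. -/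
theorem integral_kacLaw_eq (hlam : 0 ≤ lam) (μ : Measure (Omega V)) [IsProbabilityMeasure μ]
    {φ : Omega V → ℝ} (hφ : IsC10 φ) {t : ℝ} (ht : 0 ≤ t) :
    ∫ p, φ p ∂kacLaw lam μ t
      = ∫ p, φ p ∂μ + ∫ u in (0 : ℝ)..t, ∫ p, generator lam φ p ∂kacLaw lam μ u := by
  have hφc := hφ.continuous
  have hdxc := hφ.continuous_dx
  let g : Omega V → ℝ := fun p => (p.2 : ℝ) * dx φ p - lam * φ p
  have hg : Continuous g := by fun_prop
  let ψ : ℝ → Omega V → ℝ := fun s p => Real.exp (-(lam * s)) * φ (transport s p)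
  let χ : ℝ → Omega V → ℝ := fun s p => Real.exp (-(lam * s)) * g (transport s p)
  have hexp : Continuous fun z : ℝ × Omega V => Real.exp (-(lam * z.1)) := by fun_prop
  have hψ : Continuous (uncurry ψ) := hexp.mul (hφc.comp continuous_transport)
  have hχ : Continuous (uncurry χ) := hexp.mul (hg.comp continuous_transport)
  have hψj : Continuous (uncurry fun s p => ψ s (jump s p)) :=
    hψ.comp (continuous_fst.prodMk continuous_jump)
  obtain ⟨C₁, hC₁⟩ := exists_bound hφc
  obtain ⟨C₂, hC₂⟩ := exists_bound hg
  have hle : ∀ s ∈ Icc 0 t, Real.exp (-(lam * s)) ≤ 1 := fun s hs =>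
    Real.exp_le_one_iff.2 (by nlinarith [hs.1])
  have hCψ : ∀ s ∈ Icc 0 t, ∀ q, |ψ s q| ≤ max C₁ C₂ := fun s hs q => by
    rw [abs_mul, Real.abs_exp]
    exact (mul_le_of_le_one_left (abs_nonneg _) (hle s hs)).trans ((hC₁ _).trans (le_max_left _ _))
  have hCχ : ∀ s ∈ Icc 0 t, ∀ q, |χ s q| ≤ max C₁ C₂ := fun s hs q => by
    rw [abs_mul, Real.abs_exp]
    exact (mul_le_of_le_one_left (abs_nonneg _) (hle s hs)).trans ((hC₂ _).trans (le_max_right _ _))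
  have hd : ∀ q u, HasDerivAt (fun u => ψ u q) (χ u q) u := by
    intro q u
    have h1 : HasDerivAt (fun u => Real.exp (-(lam * u))) (Real.exp (-(lam * u)) * (-lam)) u := by
      have := ((hasDerivAt_id u).const_mul lam).neg.exp
      simpa using this
    refine (h1.mul (hφ.hasDerivAt_transport q u)).congr_deriv ?_
    simp only [χ, g, transport]
    ring
  have hmove : ∀ s ∈ Icc 0 t, ∀ q, ψ t q = ψ s q + ∫ u in s..t, χ u q := by
    intro s _ q
    rw [intervalIntegral.integral_eq_sub_of_hasDerivAt (fun u _ => hd q u)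
      ((hχ.comp (by fun_prop : Continuous fun u : ℝ => (u, q))).intervalIntegrable s t)]
    ring
  -- the loss term of the generator is carried by the factor `exp (-lam s)`, the gain term by `jump`
  have hD := integral_dyson_duhamel measurable_jump hlam μ ht hψ.measurable hχ.measurable
    hCψ hCχ hmove
  rw [integral_kacLaw μ t hφc]
  refine hD.trans ?_
  rw [add_assoc]
  congr 1
  · simp [ψ, transport_zero]
  · rw [← intervalIntegral.integral_const_mul, ← intervalIntegral.integral_add
      (intervalIntegrable_dyson hlam μ hχ ht hCχ)
      ((intervalIntegrable_dyson hlam μ hψj ht fun u hu q => hCψ u hu _).const_mul lam)]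
    refine intervalIntegral.integral_congr fun u hu => ?_
    rw [uIcc_of_le ht] at hu
    have := isFiniteMeasure_dyson measurable_jump hlam μ hu.1
    rw [integral_kacLaw μ u (continuous_generator hφ), ← integral_const_mul, ← integral_add]
    · refine integral_congr_ae (.of_forall fun q => ?_)
      simp only [χ, ψ, g, transport_jump, generator, dv]
      ring
    · exact integrable_of_continuous (hχ.comp (by fun_prop : Continuous fun q => (u, q))) _
    · exact (integrable_of_continuous
        (hψj.comp (by fun_prop : Continuous fun q => (u, q))) _).const_mul _

theorem continuousOn_integral_kacLaw (hlam : 0 ≤ lam) (μ : Measure (Omega V))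
    [IsProbabilityMeasure μ] {φ : Omega V → ℝ} (hφ : IsC10 φ) {T : ℝ} (hT : 0 ≤ T) :
    ContinuousOn (fun t => ∫ p, φ p ∂kacLaw lam μ t) (Icc 0 T) := by
  have h1 := intervalIntegrable_kacLaw hlam μ (continuous_generator (lam := lam) hφ) hT
  have h2 : ContinuousOn (fun t => ∫ p, φ p ∂μ
      + ∫ u in (0 : ℝ)..t, ∫ p, generator lam φ p ∂kacLaw lam μ u) (Icc 0 T) := by
    refine continuousOn_const.add ?_
    rw [intervalIntegrable_iff_integrableOn_Icc_of_le hT, ← uIcc_of_le hT] at h1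
    rw [← uIcc_of_le hT]
    exact intervalIntegral.continuousOn_primitive_interval h1
  exact h2.congr fun t ht => integral_kacLaw_eq hlam μ hφ ht.1

/-- The law of the Kac process as a narrowly continuous curve. Continuity only needs to be tested
on the monomials, because these span an algebra separating points and the state space is
compact. -/
def kacCurve (V : ℝ) {lam : ℝ} (hlam : 0 ≤ lam) {T : ℝ} (hT : 0 ≤ T)
    (σ₀ : ProbabilityMeasure (Omega V)) : Curve V T where
  toFun t := ⟨kacLaw lam σ₀ t, isProbabilityMeasure_kacLaw hlam _ (mem_Icc.1 t.2).1⟩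
  continuous_toFun := by
    have hi : ∀ (g : BoundedContinuousFunction (Omega V) ℂ) (t : Icc 0 T),
        Integrable g (kacLaw lam (σ₀ : Measure (Omega V)) t) := fun g t =>
      have := isProbabilityMeasure_kacLaw hlam (σ₀ : Measure (Omega V)) t.2.1
      integrable_of_continuous g.continuous _
    have hmono : ∀ q, Continuous fun t : Icc 0 T =>
        ∫ p, monomial V q p ∂kacLaw lam (σ₀ : Measure (Omega V)) t := by
      intro q
      have hL : ∀ L : ℂ →L[ℝ] ℝ, Continuous fun t : Icc 0 T =>
          L (∫ p, monomial V q p ∂kacLaw lam (σ₀ : Measure (Omega V)) t) := by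
        intro L
        have h1 := (isC10_comp (monomial V q).continuous
          (by fun_prop : Continuous fun p => 2 * Real.pi * Complex.I * q.1 * monomial V q p)
          (hasDerivAt_monomial q) L).1
        have h2 := continuousOn_iff_continuous_domRestrict.1
          (continuousOn_integral_kacLaw hlam (σ₀ : Measure (Omega V)) h1 hT)
        exact h2.congr fun t => L.integral_comp_comm (hi _ t)
      have h3 := Complex.equivRealProdCLM.symm.continuous.comp
        ((hL Complex.reCLM).prodMk (hL Complex.imCLM))
      exact h3.congr fun t => Complex.equivRealProdCLM.symm_apply_apply _
    refine continuous_iff_continuousAt.2 fun t => ?_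
    refine ProbabilityMeasure.tendsto_of_tight_of_separatesPoints ℂ .of_compactSpace
      trigAlgebra_separatesPoints fun g hg => ?_
    suffices h : Continuous fun t : Icc 0 T =>
      ∫ p, g p ∂kacLaw lam (σ₀ : Measure (Omega V)) t from h.tendsto t
    rw [mem_trigAlgebra] at hg
    induction hg using Submodule.span_induction with
    | mem g hg =>
      obtain ⟨q, rfl⟩ := hg
      exact hmono q
    | zero => simpa using continuous_const
    | add g g' _ _ ih ih' =>
      exact (ih.add ih').congr fun t => (integral_add (hi _ t) (hi _ t)).symm
    | smul c g _ ih =>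
      exact (ih.const_smul c).congr fun t => (integral_smul c _).symm

theorem slice_kacCurve {hlam : 0 ≤ lam} {T : ℝ} (hT : 0 ≤ T) (σ₀ : ProbabilityMeasure (Omega V))
    {t : ℝ} (ht : t ∈ Icc 0 T) :
    (slice hT (kacCurve V hlam hT σ₀) t : Measure (Omega V)) = kacLaw lam σ₀ t := by
  rw [slice, IccExtend_of_mem hT _ ht]
  rfl

theorem isWeakSolution_kacCurve (hlam : 0 ≤ lam) {T : ℝ} (hT : 0 ≤ T)
    (σ₀ : ProbabilityMeasure (Omega V)) :
    IsWeakSolution lam hT σ₀ (kacCurve V hlam hT σ₀) := by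
  constructor
  · suffices h : (slice hT (kacCurve V hlam hT σ₀) 0 : Measure (Omega V)) = σ₀ from Subtype.ext h
    rw [slice_kacCurve hT σ₀ ⟨le_rfl, hT⟩, kacLaw, dyson_eq measurable_jump, Kernel.comp_apply,
      timeKernel_apply]
    have : (transport 0 : Omega V → Omega V) = id := funext transport_zero
    simp [this]
  · intro φ hφ s t hs hst ht
    have hii : ∀ r ∈ Icc 0 T, IntervalIntegrable
        (fun u => ∫ p, generator lam φ p ∂kacLaw lam (σ₀ : Measure (Omega V)) u) volume 0 r :=
      fun r hr => intervalIntegrable_kacLaw hlam _ (continuous_generator hφ) hr.1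
    have hsT : s ∈ Icc 0 T := ⟨hs, hst.trans ht⟩
    have htT : t ∈ Icc 0 T := ⟨hs.trans hst, ht⟩
    rw [slice_kacCurve hT σ₀ htT, slice_kacCurve hT σ₀ hsT,
      integral_kacLaw_eq hlam _ hφ htT.1, integral_kacLaw_eq hlam _ hφ hs,
      add_sub_add_left_eq_sub, intervalIntegral.integral_interval_sub_left (hii t htT) (hii s hsT)]
    refine intervalIntegral.integral_congr fun r hr => ?_
    rw [uIcc_of_le hst] at hr
    rw [slice_kacCurve hT σ₀ ⟨hs.trans hr.1, hr.2.trans ht⟩]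

end Existence

/-! ### Integration against signed measures -/

section Signed

variable {X : Type*} [MeasurableSpace X]

instance (μ : SignedMeasure X) : IsFiniteMeasure μ.variation := by
  rw [← SignedMeasure.totalVariation_eq_variation]
  infer_instance

theorem integral_simpleFunc_signed (μ : SignedMeasure X) (f : SimpleFunc X ℝ) :
    ∫ᵛ x, f x ∂<•μ = ∑ y ∈ f.range, μ (f ⁻¹' {y}) * y := by
  have h1 : ∀ x, f x = ∑ y ∈ f.range, (f ⁻¹' {y}).indicator (fun _ => y) x := by
    intro x
    rw [Finset.sum_eq_single (f x)]
    · simp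
    · intro y _ hy
      exact indicator_of_notMem (fun h => hy h.symm) _
    · intro h
      exact absurd (f.mem_range_self x) h
  simp_rw [h1]
  rw [VectorMeasure.integral_finsetSum]
  · refine Finset.sum_congr rfl fun y _ => ?_
    rw [VectorMeasure.integral_indicator_const _ (f.measurableSet_preimage _)]
    simp
  · intro y _
    exact (integrable_const y).indicator (f.measurableSet_preimage _)

/-- The integral of a bounded measurable function against a measurable family of signed measures
is measurable in the parameter. -/
theorem measurable_integral_signed {ι : Type*} [MeasurableSpace ι] {j : ι → SignedMeasure X}
    (hj : ∀ B, MeasurableSet B → Measurable fun t => j t B) {f : X → ℝ} (hf : Measurable f)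
    {C : ℝ} (hC : ∀ x, |f x| ≤ C) : Measurable fun t => ∫ᵛ x, f x ∂<•(j t) := by
  have hf' := hf.stronglyMeasurable
  by_cases hX : Nonempty X
  swap
  · have := not_nonempty_iff.1 hX
    simp [VectorMeasure.integral_of_isEmpty]
  have hC0 : 0 ≤ C := (abs_nonneg _).trans (hC (Classical.arbitrary X))
  refine measurable_of_tendsto_metrizable
    (f := fun n t => ∫ᵛ x, hf'.approxBounded C n x ∂<•(j t)) (fun n => ?_) ?_
  · simp_rw [integral_simpleFunc_signed]
    exact Finset.measurable_fun_sum _ fun y _ =>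
      (hj _ (SimpleFunc.measurableSet_preimage _ _)).mul_const y
  · rw [tendsto_pi_nhds]
    intro t
    refine VectorMeasure.tendsto_integral_filter_of_norm_le_const
      (.of_forall fun n => (SimpleFunc.stronglyMeasurable _).aestronglyMeasurable)
      ⟨C, .of_forall fun n => .of_forall fun x => hf'.norm_approxBounded_le hC0 n x⟩
      (.of_forall fun x => hf'.tendsto_approxBounded_of_norm_le (hC x))

end Signed

/-! ### Weak and variational solutions -/

section Variational

variable {V T lam : ℝ}

/-- A narrowly continuous family of probability measures is measurable, since the mass of a closed
set is a limit of integrals of bounded continuous functions. -/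
theorem measurable_slice (hT : 0 ≤ T) (σ : Curve V T) :
    Measurable fun t => (slice hT σ t : Measure (Omega V)) := by
  refine Measurable.measure_of_isPiSystem_of_isProbabilityMeasure
    (S := {s | IsClosed s})
    (by rw [BorelSpace.measurable_eq (α := Omega V), borel_eq_generateFrom_isClosed])
    isPiSystem_isClosed fun F hF => ?_
  have hF : IsClosed F := hF
  refine measurable_of_tendsto_metrizable
    (f := fun n t => ∫⁻ p, hF.apprSeq n p ∂(slice hT σ t : Measure (Omega V))) (fun n => ?_) ?_
  · exact (continuous_iff_continuousAt.2 fun t =>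
      (ProbabilityMeasure.tendsto_iff_forall_lintegral_tendsto.1
        (continuous_slice hT σ).continuousAt) (hF.apprSeq n)).measurable
  · rw [tendsto_pi_nhds]
    intro t
    exact HasOuterApproxClosed.tendsto_lintegral_apprSeq hF _

theorem continuous_dv {φ : Omega V → ℝ} (hφ : Continuous φ) : Continuous (dv φ) := by
  unfold dv
  fun_prop

/-- The flux `(v σ, lam σ)` of the Kac equation. The signed measure `v σ` is written as the
difference of `V σ` on `{v = V}` and `V σ` on the complement, where `v = -V`. -/
def kacFlux (lam : ℝ) (σ : Measure (Omega V)) [IsFiniteMeasure σ] : Flux V :=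
  (V • (σ.restrict {p | (p.2 : ℝ) = V}).toSignedMeasure
    - V • (σ.restrict {p | (p.2 : ℝ) = V}ᶜ).toSignedMeasure, lam • σ.toSignedMeasure)

theorem measurableSet_velocity : MeasurableSet {p : Omega V | (p.2 : ℝ) = V} :=
  measurableSet_eq_fun continuous_velocity.measurable measurable_const

theorem pairing_kacFlux (σ : Measure (Omega V)) [IsFiniteMeasure σ] {φ₁ φ₂ : Omega V → ℝ}
    (h₁ : Continuous φ₁) (h₂ : Continuous φ₂) :
    pairing φ₁ φ₂ (kacFlux lam σ) = ∫ p, ((p.2 : ℝ) * φ₁ p + lam * φ₂ p) ∂σ := by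
  have hi : ∀ (f : Omega V → ℝ) (μ : SignedMeasure (Omega V)), Continuous f → μ.Integrable f :=
    fun f μ hf => integrable_of_continuous hf _
  have hS := measurableSet_velocity (V := V)
  rw [pairing, kacFlux, VectorMeasure.integral_sub_vectorMeasure (hi _ _ h₁) (hi _ _ h₁),
    VectorMeasure.integral_smul_vectorMeasure, VectorMeasure.integral_smul_vectorMeasure,
    VectorMeasure.integral_smul_vectorMeasure, VectorMeasure.integral_toSignedMeasure,
    VectorMeasure.integral_toSignedMeasure, VectorMeasure.integral_toSignedMeasure,
    integral_add (integrable_of_continuous (by fun_prop) _)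
      (integrable_of_continuous (by fun_prop) _), integral_const_mul,
    ← integral_add_compl hS (integrable_of_continuous (f := fun p : Omega V => (p.2 : ℝ) * φ₁ p)
      (by fun_prop) σ)]
  have e1 : ∫ p in {p : Omega V | (p.2 : ℝ) = V}, (p.2 : ℝ) * φ₁ p ∂σ
      = V * ∫ p in {p : Omega V | (p.2 : ℝ) = V}, φ₁ p ∂σ := by
    rw [← integral_const_mul]
    refine setIntegral_congr_fun hS fun p hp => ?_
    simp only [mem_ofPred_eq] at hp
    simp only [hp]
  have e2 : ∫ p in {p : Omega V | (p.2 : ℝ) = V}ᶜ, (p.2 : ℝ) * φ₁ p ∂σ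
      = -(V * ∫ p in {p : Omega V | (p.2 : ℝ) = V}ᶜ, φ₁ p ∂σ) := by
    rw [← integral_const_mul, ← integral_neg]
    refine setIntegral_congr_fun hS.compl fun p hp => ?_
    have : (p.2 : ℝ) = -V := by
      rcases p.2.2 with h | h
      · exact h
      · exact absurd h hp
    simp only [this]
    ring
  rw [e1, e2]
  simp only [smul_eq_mul]
  ring

theorem measurable_kacFlux_fst (hT : 0 ≤ T) (σ : Curve V T) {B : Set (Omega V)}
    (hB : MeasurableSet B) :
    Measurable fun t => (kacFlux lam (slice hT σ t : Measure (Omega V))).1 B := by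
  have h : ∀ A : Set (Omega V), MeasurableSet A → Measurable fun t =>
      ((slice hT σ t : Measure (Omega V)).restrict A).toSignedMeasure B := by
    intro A hA
    simp_rw [Measure.toSignedMeasure_apply_measurable hB, measureReal_restrict_apply hB]
    exact ((Measure.measurable_coe (hB.inter hA)).comp (measurable_slice hT σ)).ennreal_toReal
  exact ((h _ measurableSet_velocity).const_mul V).sub
    ((h _ measurableSet_velocity.compl).const_mul V)

theorem measurable_kacFlux_snd (hT : 0 ≤ T) (σ : Curve V T) {B : Set (Omega V)}
    (hB : MeasurableSet B) :
    Measurable fun t => (kacFlux lam (slice hT σ t : Measure (Omega V))).2 B := by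
  have h : Measurable fun t => (slice hT σ t : Measure (Omega V)).toSignedMeasure B := by
    simp_rw [Measure.toSignedMeasure_apply_measurable hB]
    exact ((Measure.measurable_coe hB).comp (measurable_slice hT σ)).ennreal_toReal
  exact h.const_mul lam

theorem tvNorm_kacFlux_le (hV : 0 < V) (hlam : 0 ≤ lam) (σ : Measure (Omega V))
    [IsProbabilityMeasure σ] : tvNorm (kacFlux lam σ) ≤ ENNReal.ofReal (V + lam) := by
  refine iSup_le fun φ => ENNReal.ofReal_le_ofReal ?_
  rw [pairing_kacFlux σ φ.1.1.continuous φ.1.2.continuous]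
  refine (le_abs_self _).trans ?_
  have h : ∀ p : Omega V, ‖(p.2 : ℝ) * φ.1.1 p + lam * φ.1.2 p‖ ≤ V + lam := by
    intro p
    have h1 := (φ.2 p).1
    have h2 := (φ.2 p).2
    refine (norm_add_le _ _).trans ?_
    rw [Real.norm_eq_abs, Real.norm_eq_abs, abs_mul, abs_mul, abs_velocity hV, abs_of_nonneg hlam]
    exact add_le_add (mul_le_of_le_one_right hV.le h1) (mul_le_of_le_one_right hlam h2)
  simpa using norm_integral_le_of_norm_le_const (μ := σ) (.of_forall h)

/-- The flux `(v σ, lam σ)` has zero cost, because `x ≤ exp x - 1`. -/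
theorem lagrangian_kacFlux (hlam : 0 ≤ lam) (σ : ProbabilityMeasure (Omega V)) :
    lagrangian lam σ (kacFlux lam (σ : Measure (Omega V))) = 0 := by
  refine ENNReal.iSup_eq_zero.2 fun φ => ENNReal.ofReal_eq_zero.2 ?_
  have h1 := φ.1.continuous
  have h2 := φ.2.continuous
  rw [pairing_kacFlux _ h1 h2, hamiltonian, sub_nonpos]
  refine integral_mono (integrable_of_continuous (by fun_prop) _)
    (integrable_of_continuous (by fun_prop) _) fun p => ?_
  have := Real.add_one_le_exp (φ.2 p)
  have := mul_le_mul_of_nonneg_left (by linarith : φ.2 p ≤ Real.exp (φ.2 p) - 1) hlam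
  simp only
  linarith

theorem IsWeakSolution.isVariationalSolution (hV : 0 < V) (hlam : 0 ≤ lam) {hT : 0 ≤ T}
    {σ₀ : ProbabilityMeasure (Omega V)} {σ : Curve V T} (hσ : IsWeakSolution lam hT σ₀ σ) :
    IsVariationalSolution lam hT σ₀ σ := by
  have hCE : ContinuityEquation hT σ
      fun t => kacFlux lam (slice hT σ t : Measure (Omega V)) := by
    refine ⟨fun B hB => (measurable_kacFlux_fst hT σ hB).comp measurable_subtype_coe,
      fun B hB => (measurable_kacFlux_snd hT σ hB).comp measurable_subtype_coe, ?_, ?_⟩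
    · refine (lintegral_mono fun t => tvNorm_kacFlux_le hV hlam _).trans_lt ?_
      rw [lintegral_const]
      exact ENNReal.mul_lt_top ENNReal.ofReal_lt_top (measure_lt_top _ _)
    · intro φ hφ s t hs hst ht
      rw [hσ.2 φ hφ s t hs hst ht]
      refine intervalIntegral.integral_congr fun r _ => ?_
      rw [pairing_kacFlux _ hφ.continuous_dx (continuous_dv hφ.continuous)]
      rfl
  refine ⟨_, hCE, ?_⟩
  rw [rate, if_pos hCE, hσ.1, relEnt_eq_klDiv, InformationTheory.klDiv_self, zero_add]
  simp_rw [lagrangian_kacFlux hlam]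
  exact lintegral_zero

theorem measurable_pairing {j : ℝ → Flux V}
    (h₁ : ∀ B : Set (Omega V), MeasurableSet B → Measurable fun t : Ioo (0 : ℝ) T => (j t).1 B)
    (h₂ : ∀ B : Set (Omega V), MeasurableSet B → Measurable fun t : Ioo (0 : ℝ) T => (j t).2 B)
    {φ₁ φ₂ : Omega V → ℝ} (hφ₁ : Continuous φ₁) (hφ₂ : Continuous φ₂) :
    Measurable fun t : Ioo (0 : ℝ) T => pairing φ₁ φ₂ (j t) := by
  obtain ⟨C₁, hC₁⟩ := exists_bound hφ₁
  obtain ⟨C₂, hC₂⟩ := exists_bound hφ₂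
  exact (measurable_integral_signed (j := fun t : Ioo (0 : ℝ) T => (j t).1) h₁
    hφ₁.measurable hC₁).add (measurable_integral_signed (j := fun t : Ioo (0 : ℝ) T => (j t).2) h₂
    hφ₂.measurable hC₂)

/-- If the rate vanishes, then for a fixed pair of test functions the cost is not positive at
almost every time. Fixing the pair avoids measurability of the Lagrangian, a supremum over an
uncountable family. -/
theorem ae_pairing_le_hamiltonian {hT : 0 ≤ T} {σ : Curve V T} {j : ℝ → Flux V}
    (hj : ContinuityEquation hT σ j)
    (h0 : ∫⁻ t in Ioo (0 : ℝ) T, lagrangian lam (slice hT σ t) (j t) = 0)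
    {φ₁ φ₂ : Omega V → ℝ} (hφ₁ : Continuous φ₁) (hφ₂ : Continuous φ₂) :
    ∀ᵐ t ∂volume.restrict (Ioo (0 : ℝ) T),
      pairing φ₁ φ₂ (j t) ≤ hamiltonian lam (slice hT σ t) φ₁ φ₂ := by
  set F : ℝ → ℝ≥0∞ := fun t =>
    ENNReal.ofReal (pairing φ₁ φ₂ (j t) - hamiltonian lam (slice hT σ t) φ₁ φ₂) with hF
  have hmeas : AEMeasurable F (volume.restrict (Ioo (0 : ℝ) T)) := by
    refine aemeasurable_restrict_of_measurable_subtype measurableSet_Ioo ?_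
    refine ((measurable_pairing hj.measurable_fst hj.measurable_snd hφ₁ hφ₂).sub ?_).ennreal_ofReal
    exact (continuous_integral_slice hT σ (by fun_prop)).measurable.comp measurable_subtype_coe
  have hle : ∫⁻ t in Ioo (0 : ℝ) T, F t ≤ 0 := by
    rw [← h0]
    exact lintegral_mono fun t =>
      le_iSup (fun φ : C(Omega V, ℝ) × C(Omega V, ℝ) => ENNReal.ofReal
        (pairing φ.1 φ.2 (j t) - hamiltonian lam (slice hT σ t) φ.1 φ.2)) (⟨φ₁, hφ₁⟩, ⟨φ₂, hφ₂⟩)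
  filter_upwards [(lintegral_eq_zero_iff' hmeas).1 (nonpos_iff_eq_zero.1 hle)] with t ht
  exact sub_nonpos.1 (ENNReal.ofReal_eq_zero.1 ht)

theorem pairing_smul (c : ℝ) (φ₁ φ₂ : Omega V → ℝ) (j : Flux V) :
    pairing (fun p => c * φ₁ p) (fun p => c * φ₂ p) j = c * pairing φ₁ φ₂ j := by
  have h : ∀ (μ : SignedMeasure (Omega V)) (f : Omega V → ℝ),
      ∫ᵛ p, c * f p ∂<•μ = c * ∫ᵛ p, f p ∂<•μ := fun μ f =>
    VectorMeasure.integral_fun_smul μ _ c f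
  rw [pairing, pairing, h, h, mul_add]

/-- If the rate vanishes, the flux acts on a fixed pair of test functions at most as `(v σ, lam σ)`
does, for almost every time: this is the linearisation of the optimality condition at `φ = 0`,
obtained along the test functions `φ / n`. -/
theorem ae_pairing_le_integral (hlam : 0 ≤ lam) {hT : 0 ≤ T} {σ : Curve V T} {j : ℝ → Flux V}
    (hj : ContinuityEquation hT σ j)
    (h0 : ∫⁻ t in Ioo (0 : ℝ) T, lagrangian lam (slice hT σ t) (j t) = 0)
    {φ₁ φ₂ : Omega V → ℝ} (hφ₁ : Continuous φ₁) (hφ₂ : Continuous φ₂) :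
    ∀ᵐ t ∂volume.restrict (Ioo (0 : ℝ) T), pairing φ₁ φ₂ (j t)
      ≤ ∫ p, ((p.2 : ℝ) * φ₁ p + lam * φ₂ p) ∂(slice hT σ t : Measure (Omega V)) := by
  obtain ⟨C, hC⟩ := exists_bound hφ₂
  have h1 : ∀ n : ℕ, ∀ᵐ t ∂volume.restrict (Ioo (0 : ℝ) T),
      pairing (fun p => (n + 1 : ℝ)⁻¹ * φ₁ p) (fun p => (n + 1 : ℝ)⁻¹ * φ₂ p) (j t)
        ≤ hamiltonian lam (slice hT σ t) (fun p => (n + 1 : ℝ)⁻¹ * φ₁ p)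
          (fun p => (n + 1 : ℝ)⁻¹ * φ₂ p) := fun n =>
    ae_pairing_le_hamiltonian hj h0 (by fun_prop) (by fun_prop)
  filter_upwards [ae_all_iff.2 h1] with t ht
  set q := ∫ p, ((p.2 : ℝ) * φ₁ p + lam * φ₂ p) ∂(slice hT σ t : Measure (Omega V)) with hq
  have hlim : Tendsto (fun n : ℕ => q + lam * C ^ 2 * (n + 1 : ℝ)⁻¹) atTop (𝓝 q) := by
    have := (tendsto_one_div_add_atTop_nhds_zero_nat (𝕜 := ℝ)).const_mul (lam * C ^ 2)
    simpa [one_div] using this.const_add q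
  obtain ⟨N, hN⟩ := exists_nat_gt C
  -- only the `n ≥ C` are used, for which `|φ₂ / (n + 1)| ≤ 1` and `|exp x - 1 - x| ≤ x ^ 2` applies
  refine ge_of_tendsto hlim ((eventually_ge_atTop N).mono fun n hn => ?_)
  have hpos : (0 : ℝ) < n + 1 := by positivity
  have hCn : C ≤ n + 1 := by
    have : (N : ℝ) ≤ n := by exact_mod_cast hn
    linarith
  set c : ℝ := (n + 1 : ℝ)⁻¹ with hc
  have hc0 : 0 < c := inv_pos.2 hpos
  have hcC : c * C ≤ 1 := by
    rw [hc, inv_mul_le_iff₀ hpos, mul_one]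
    exact hCn
  have h2 : hamiltonian lam (slice hT σ t) (fun p => c * φ₁ p) (fun p => c * φ₂ p)
      ≤ ∫ p, (c * ((p.2 : ℝ) * φ₁ p + lam * φ₂ p) + lam * (c ^ 2 * C ^ 2))
        ∂(slice hT σ t : Measure (Omega V)) := by
    refine integral_mono (integrable_of_continuous (by fun_prop) _)
      (integrable_of_continuous (by fun_prop) _) fun p => ?_
    have hx : |c * φ₂ p| ≤ c * C := by
      rw [abs_mul, abs_of_pos hc0]
      exact mul_le_mul_of_nonneg_left (hC p) hc0.le
    have e1 := (abs_le.1 (Real.abs_exp_sub_one_sub_id_le (hx.trans hcC))).2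
    have e2 : (c * φ₂ p) ^ 2 ≤ (c * C) ^ 2 := sq_le_sq' (abs_le.1 hx).1 (abs_le.1 hx).2
    have e3 := mul_le_mul_of_nonneg_left
      (by linarith : Real.exp (c * φ₂ p) - 1 ≤ c * φ₂ p + (c * C) ^ 2) hlam
    simp only
    linarith
  rw [integral_add (integrable_of_continuous (by fun_prop) _) (integrable_const _),
    integral_const_mul, ← hq, integral_const, probReal_univ, one_smul] at h2
  have h3 := (ht n).trans h2
  rw [pairing_smul] at h3
  have h4 : c * pairing φ₁ φ₂ (j t) ≤ c * (q + lam * C ^ 2 * c) := by linarith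
  exact le_of_mul_le_mul_left h4 hc0

theorem IsVariationalSolution.isWeakSolution (hlam : 0 ≤ lam) {hT : 0 ≤ T}
    {σ₀ : ProbabilityMeasure (Omega V)} {σ : Curve V T}
    (hσ : IsVariationalSolution lam hT σ₀ σ) : IsWeakSolution lam hT σ₀ σ := by
  obtain ⟨j, hj, h⟩ := hσ
  obtain ⟨hent, hrate⟩ := add_eq_zero.1 h
  rw [relEnt_eq_klDiv, InformationTheory.klDiv_eq_zero_iff] at hent
  rw [rate, if_pos hj] at hrate
  refine ⟨Subtype.ext hent, fun φ hφ s t hs hst ht => ?_⟩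
  rw [hj.weak φ hφ s t hs hst ht]
  have h1 := hφ.continuous_dx
  have h2 := continuous_dv hφ.continuous
  have hae : ∀ᵐ r ∂volume.restrict (Ioo (0 : ℝ) T), pairing (dx φ) (dv φ) (j r)
      = ∫ p, generator lam φ p ∂(slice hT σ r : Measure (Omega V)) := by
    filter_upwards [ae_pairing_le_integral hlam hj hrate h1 h2,
      ae_pairing_le_integral hlam hj hrate (φ₁ := fun p => -1 * dx φ p)
        (φ₂ := fun p => -1 * dv φ p) (by fun_prop) (by fun_prop)] with r hr hr'
    refine le_antisymm hr ?_
    rw [pairing_smul] at hr'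
    have : ∫ p, ((p.2 : ℝ) * (-1 * dx φ p) + lam * (-1 * dv φ p))
        ∂(slice hT σ r : Measure (Omega V))
        = -∫ p, generator lam φ p ∂(slice hT σ r : Measure (Omega V)) := by
      rw [← integral_neg]
      refine integral_congr_ae (.of_forall fun p => ?_)
      simp only [generator]
      ring
    linarith
  rw [intervalIntegral.integral_of_le hst, intervalIntegral.integral_of_le hst,
    integral_Ioc_eq_integral_Ioo, integral_Ioc_eq_integral_Ioo]
  exact integral_congr_ae (ae_restrict_of_ae_restrict_of_subset (Ioo_subset_Ioo hs ht) hae)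

end Variational

end

end Kac

theorem theorem2p4 (V lam T : ℝ) (hV : 0 < V) (hlam : 0 < lam) (hT : 0 < T)
    (σ₀ : MeasureTheory.ProbabilityMeasure (Kac.Omega V)) :
    (∃! σ : Kac.Curve V T, Kac.IsWeakSolution lam hT.le σ₀ σ) ∧
    ∀ σ : Kac.Curve V T,
      Kac.IsWeakSolution lam hT.le σ₀ σ ↔ Kac.IsVariationalSolution lam hT.le σ₀ σ :=
  ⟨⟨Kac.kacCurve V hlam.le hT.le σ₀, Kac.isWeakSolution_kacCurve hlam.le hT.le σ₀,
    fun _ hσ => hσ.unique (Kac.isWeakSolution_kacCurve hlam.le hT.le σ₀)⟩,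
    fun _ => ⟨fun h => h.isVariationalSolution hV hlam.le, fun h => h.isWeakSolution hlam.le⟩⟩
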